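/- Let $G$ be a finite simple unicyclic graph (connected, with exactly one cycle $C$) of girth at least $4$. A set $S\subseteq V(G)$ is a resolving set if for any two distinct vertices $x,y$ there is $s\in S$ with $d(x,s)\neq d(y,s)$; a metric basis is a resolving set of minimum cardinality, and this cardinality is the metric dimension $\dim(G)$. A vertex is basis forced if it belongs to every metric basis of $G$. A thread attached to a vertex $v$ of degree at least $3$ is a path $u_1u_2\cdots u_m$ ($m\ge 1$) not containing $v$ such that $u_1$ is adjacent to $v$, the vertices $u_1,\dots,u_{m-1}$ have degree $2$ in $G$, and $u_m$ has degree $1$ in $G$. Let $\ell(v)$ be the number of threads attached to $v$, and let $$L(G)=\sum_{v\in V(G),\ \ell(v)>1}(\ell(v)-1).$$ A vertex $v$ is branching if $v\in V(C)$ and $\deg(v)\ge 4$, or $v\notin V(C)$ and $\deg(v)\ge 3$. A vertex $v\in V(C)$ is branch-active if the component of $G-E(C)$ containing $v$ contains a branching vertex; $b(G)$ denotes the number of branch-active vertices of $C$. Theorem. If $G$ has at least one basis forced vertex, then $$\dim(G)=L(G)+\max\{2-b(G),0\}.$$ -/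

import Mathlib

namespace UnicyclicMetric

variable {V : Type*}

/-- A subgraph that is a cycle: the subgraph traced out by a closed walk of length at least three
without repeated vertices (other than its base point). -/
def IsCycleSubgraph (G : SimpleGraph V) (C : G.Subgraph) : Prop :=
  ∃ (u : V) (w : G.Walk u u), w.IsCycle ∧ w.toSubgraph = C

/-- A unicyclic graph: connected, with exactly one cycle. -/
def IsUnicyclic (G : SimpleGraph V) : Prop :=
  G.Connected ∧ ∃! C : G.Subgraph, IsCycleSubgraph G C

/-- The vertices lying on a cycle of `G`; in a unicyclic graph this is `V(C)`. -/
def cycleVerts (G : SimpleGraph V) : Set V :=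
  {v | ∃ C : G.Subgraph, IsCycleSubgraph G C ∧ v ∈ C.verts}

/-- The edges lying on a cycle of `G`; in a unicyclic graph this is `E(C)`. -/
def cycleEdges (G : SimpleGraph V) : Set (Sym2 V) :=
  {e | ∃ C : G.Subgraph, IsCycleSubgraph G C ∧ e ∈ C.edgeSet}

/-- The vertex set of the component of `G - E(C)` that contains `v`. -/
def hangingTree (G : SimpleGraph V) (v : V) : Set V :=
  {u | (G.deleteEdges (cycleEdges G)).Reachable v u}

/-- `S` is a resolving set: any two distinct vertices are resolved by a vertex of `S`. -/
def IsResolving (G : SimpleGraph V) (S : Finset V) : Prop :=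
  ∀ x y : V, x ≠ y → ∃ s ∈ S, G.dist x s ≠ G.dist y s

/-- A metric basis is a resolving set of the smallest possible cardinality. -/
def IsMetricBasis (G : SimpleGraph V) (S : Finset V) : Prop :=
  IsResolving G S ∧ ∀ T : Finset V, IsResolving G T → S.card ≤ T.card

/-- The metric dimension. -/
noncomputable def metricDim (G : SimpleGraph V) : ℕ :=
  sInf {n | ∃ S : Finset V, IsResolving G S ∧ S.card = n}

/-- A basis forced vertex belongs to every metric basis. -/
def IsBasisForced (G : SimpleGraph V) (v : V) : Prop :=
  ∀ S : Finset V, IsMetricBasis G S → v ∈ S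

section Threads

variable [Fintype V] (G : SimpleGraph V) [DecidableRel G.Adj]

/-- The walk `p` from `v` to `u` runs through a thread attached to `v`: `v` has degree at least
three, `p` is a path, its last vertex `u` has degree one, and all the vertices strictly between `v`
and `u` have degree two. The thread itself is `p` without its first vertex `v`. -/
def IsThread {v u : V} (p : G.Walk v u) : Prop :=
  3 ≤ G.degree v ∧ p.IsPath ∧ G.degree u = 1 ∧
    ∀ x ∈ p.support, x ≠ v → x ≠ u → G.degree x = 2

/-- The number `ℓ(v)` of threads attached to `v`. Threads are counted by their end-vertices of
degree one: the thread ending in a given leaf is unique, since it can be traced back from that leaf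
through vertices of degree two in only one way. -/
noncomputable def numThreads (v : V) : ℕ :=
  {u : V | ∃ p : G.Walk v u, IsThread G p}.ncard

/-- `L(G)`, the sum of `ℓ(v) - 1` over all vertices `v` with `ℓ(v) > 1`. -/
noncomputable def branchSum : ℕ :=
  ∑ v : V with 1 < numThreads G v, (numThreads G v - 1)

/-- Branching vertices: degree at least four on the cycle, degree at least three off the cycle. -/
def IsBranching (v : V) : Prop :=
  (v ∈ cycleVerts G ∧ 4 ≤ G.degree v) ∨ (v ∉ cycleVerts G ∧ 3 ≤ G.degree v)

/-- A vertex of the cycle is branch-active if the component of `G - E(C)` containing it has a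
branching vertex. -/
def IsBranchActive (v : V) : Prop :=
  v ∈ cycleVerts G ∧ ∃ u ∈ hangingTree G v, IsBranching G u

/-- `b(G)`, the number of branch-active vertices on the cycle. -/
noncomputable def numBranchActive : ℕ :=
  {v : V | IsBranchActive G v}.ncard

end Threads

end UnicyclicMetric

namespace UnicyclicMetric

variable {V : Type*}

/-! Let `m` be the right-hand side of the formula. Two facts suffice: every resolving set has at
least `m` vertices (`branchSum_add_le_card`), and every vertex `v` is avoided by a resolving set
with at most `m + 1` vertices (`exists_isResolving_notMem`). If `v` is basis forced, the latter set
is not a metric basis, so the dimension is below `m + 1`.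

Lower bound: two threads with the same head cannot both be free of landmarks (the chosen vertices),
which costs `L(G)` landmarks, all in the trees of branch-active vertices. Moreover, landmarks must
occupy the trees of two cycle vertices, so at least `2 - b(G)` more lie in trees of inactive ones.

Upper bound: take all thread ends but one per head, and cycle vertices making up two occupied trees.
A third cycle vertex turns the two positions into a doubly resolving set of the cycle, and this
makes the whole set resolving (`isResolving_of_isDoublyResolving`). The omitted thread ends and the
added cycle vertices can be chosen so as to avoid `v`.

All of this is carried out in a functional-graph presentation, where every edge joins some `x` to
`next x`. -/

/-- A presentation of a unicyclic graph as a functional graph: `next` is the successor along the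
cycle on the vertices of the cycle `core`, and the parent (towards the cycle) elsewhere. -/
structure Rooting (G : SimpleGraph V) where
  next : V → V
  core : Set V
  len : ℕ
  three_le_len : 3 ≤ len
  connected : G.Connected
  adj_iff : ∀ x y, G.Adj x y ↔ next x = y ∨ next y = x
  next_mem : ∀ x ∈ core, next x ∈ core
  exists_iterate_mem : ∀ x, ∃ n, next^[n] x ∈ core
  iterate_len : ∀ a ∈ core, next^[len] a = a
  iterate_ne : ∀ a ∈ core, ∀ i < len, 0 < i → next^[i] a ≠ a
  exists_iterate_eq : ∀ a ∈ core, ∀ b ∈ core, ∃ i < len, next^[i] a = b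

/-- A function growing by at most one along edges grows by at most the distance. -/
theorem le_add_dist_of_adj {G : SimpleGraph V} (hG : G.Connected) (φ : V → ℕ)
    (h : ∀ x y, G.Adj x y → φ x ≤ φ y + 1) (x y : V) : φ x ≤ φ y + G.dist x y := by
  obtain ⟨w, hw⟩ := hG.exists_walk_length_eq_dist x y
  rw [← hw]
  clear hw
  induction w with
  | nil => simp
  | cons hadj p ih =>
    have := h _ _ hadj
    rw [SimpleGraph.Walk.length_cons]
    omega

/-! ### Depth, projection to the cycle and distance formulas. -/

namespace Rooting

variable {G : SimpleGraph V} (R : Rooting G)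

theorem adj_next (x : V) : G.Adj x (R.next x) := (R.adj_iff _ _).2 (Or.inl rfl)

theorem next_ne (x : V) : R.next x ≠ x := (R.adj_next x).ne'

theorem iterate_mem {x : V} (hx : x ∈ R.core) (n : ℕ) : R.next^[n] x ∈ R.core := by
  induction n with
  | zero => exact hx
  | succ n ih => rw [Function.iterate_succ_apply']; exact R.next_mem _ ih

/-- Otherwise the orbit of `x`, which reaches the cycle, would have period two, while the cycle has
length at least three. -/
theorem next_next_ne (x : V) : R.next (R.next x) ≠ x := by
  intro h
  have h2 : ∀ n, R.next^[n] x = x ∨ R.next^[n] x = R.next x := by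
    intro n
    induction n with
    | zero => exact Or.inl rfl
    | succ n ih =>
      rw [Function.iterate_succ_apply']
      rcases ih with ih | ih <;> rw [ih]
      · exact Or.inr rfl
      · exact Or.inl h
  obtain ⟨n, hn⟩ := R.exists_iterate_mem x
  have hx : x ∈ R.core := by
    rcases h2 n with h' | h' <;> rw [h'] at hn
    · exact hn
    · rw [← h]; exact R.next_mem _ hn
  have := R.three_le_len
  exact R.iterate_ne x hx 2 (by omega) (by omega) h

theorem exists_core_child {c : V} (hc : c ∈ R.core) : ∃ e ∈ R.core, R.next e = c := by
  have h3 := R.three_le_len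
  refine ⟨R.next^[R.len - 1] c, R.iterate_mem hc _, ?_⟩
  rw [← Function.iterate_succ_apply' R.next, Nat.succ_eq_add_one, Nat.sub_add_cancel (by omega),
    R.iterate_len c hc]

theorem core_child_unique {a b : V} (ha : a ∈ R.core) (hb : b ∈ R.core)
    (h : R.next a = R.next b) : a = b := by
  have h3 := R.three_le_len
  have key : ∀ x ∈ R.core, R.next^[R.len - 1] (R.next x) = x := by
    intro x hx
    rw [← Function.iterate_succ_apply, Nat.succ_eq_add_one, Nat.sub_add_cancel (by omega),
      R.iterate_len x hx]
  rw [← key a ha, h, key b hb]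

open Classical in
/-- The distance to the cycle along `next`. -/
noncomputable def depth (x : V) : ℕ := Nat.find (R.exists_iterate_mem x)

/-- The vertex of the cycle in whose hanging tree `x` lies. -/
noncomputable def proj (x : V) : V := R.next^[R.depth x] x

theorem proj_mem (x : V) : R.proj x ∈ R.core := by
  classical exact Nat.find_spec (R.exists_iterate_mem x)

theorem iterate_notMem {x : V} {i : ℕ} (hi : i < R.depth x) : R.next^[i] x ∉ R.core := by
  classical exact Nat.find_min (R.exists_iterate_mem x) hi

theorem depth_of_mem {x : V} (hx : x ∈ R.core) : R.depth x = 0 := by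
  by_contra h
  exact R.iterate_notMem (x := x) (i := 0) (by omega) hx

theorem proj_of_mem {x : V} (hx : x ∈ R.core) : R.proj x = x := by
  rw [proj, R.depth_of_mem hx, Function.iterate_zero_apply]

theorem depth_of_notMem {x : V} (hx : x ∉ R.core) : R.depth x = R.depth (R.next x) + 1 := by
  have h1 : R.depth x ≠ 0 := by
    intro h
    have := R.proj_mem x
    rw [proj, h] at this
    exact hx this
  apply le_antisymm
  · by_contra! hlt
    exact R.iterate_notMem hlt (R.proj_mem (R.next x))
  · obtain ⟨d, hd⟩ := Nat.exists_eq_succ_of_ne_zero h1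
    by_contra! hlt
    have h2 : d < R.depth (R.next x) := by omega
    apply R.iterate_notMem h2
    rw [← Function.iterate_succ_apply, ← hd]
    exact R.proj_mem x

theorem proj_next {x : V} (hx : x ∉ R.core) : R.proj (R.next x) = R.proj x := by
  rw [proj, proj, R.depth_of_notMem hx, Function.iterate_succ_apply]

theorem notMem_of_iterate {x : V} {i : ℕ} (h : R.next^[i] x ∉ R.core) : x ∉ R.core :=
  fun hx => h (R.iterate_mem hx i)

theorem notMem_of_iterate_le {x : V} {i j : ℕ} (h : R.next^[i] x ∉ R.core) (hj : j ≤ i) :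
    R.next^[j] x ∉ R.core := by
  apply R.notMem_of_iterate (i := i - j)
  rwa [← Function.iterate_add_apply, Nat.sub_add_cancel hj]

theorem depth_iterate {x : V} {i : ℕ} (h : R.next^[i] x ∉ R.core) :
    R.depth x = R.depth (R.next^[i] x) + i := by
  induction i with
  | zero => rfl
  | succ i ih =>
    have h' := R.notMem_of_iterate_le h (Nat.le_succ i)
    rw [ih h', R.depth_of_notMem h', Function.iterate_succ_apply']
    omega

theorem proj_iterate {x : V} {i : ℕ} (h : R.next^[i] x ∉ R.core) :
    R.proj (R.next^[i] x) = R.proj x := by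
  induction i with
  | zero => rfl
  | succ i ih =>
    have h' := R.notMem_of_iterate_le h (Nat.le_succ i)
    rw [Function.iterate_succ_apply', R.proj_next h', ih h']

/-- The vertices whose `next`-orbit runs through `z`. -/
def below (z : V) : Set V := {y | ∃ i, R.next^[i] y = z}

theorem mem_below_self (z : V) : z ∈ R.below z := ⟨0, rfl⟩

theorem mem_below_of_iterate {x z : V} {i : ℕ} (h : R.next^[i] x ∈ R.below z) : x ∈ R.below z := by
  obtain ⟨j, hj⟩ := h
  exact ⟨j + i, by rw [Function.iterate_add_apply, hj]⟩

theorem proj_of_mem_below {y z : V} (hz : z ∉ R.core) (hy : y ∈ R.below z) :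
    R.proj y = R.proj z := by
  obtain ⟨i, rfl⟩ := hy
  rw [R.proj_iterate hz]

theorem depth_le_of_mem_below {y z : V} (hz : z ∉ R.core) (hy : y ∈ R.below z) :
    R.depth z ≤ R.depth y := by
  obtain ⟨i, rfl⟩ := hy
  rw [R.depth_iterate hz]
  omega

theorem next_notMem_below {z : V} (hz : z ∉ R.core) : R.next z ∉ R.below z := by
  intro h
  have h1 := R.depth_le_of_mem_below hz h
  rw [R.depth_of_notMem hz] at h1
  omega

/-- Siblings outside the cycle have disjoint sets of descendants. -/
theorem notMem_below_of_sibling {x y s : V} (hx : x ∉ R.core) (hy : y ∉ R.core) (hxy : x ≠ y)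
    (h : R.next x = R.next y) (hs : s ∈ R.below x) : s ∉ R.below y := by
  rintro ⟨j, hj⟩
  obtain ⟨i, hi⟩ := hs
  have h1 := R.depth_iterate (x := s) (i := i) (by rwa [hi])
  have h2 := R.depth_iterate (x := s) (i := j) (by rwa [hj])
  rw [hi, R.depth_of_notMem hx] at h1
  rw [hj, R.depth_of_notMem hy, ← h] at h2
  have : i = j := by omega
  subst this
  exact hxy (hi.symm.trans hj)

/-- The edge from `z` to its parent is the only one leaving the subtree below `z`. -/
theorem dist_eq_of_notMem_below {z y : V} (hz : z ∉ R.core) (hy : y ∉ R.below z) :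
    G.dist z y = 1 + G.dist (R.next z) y := by
  classical
  apply le_antisymm
  · have := R.connected.dist_triangle (u := z) (v := R.next z) (w := y)
    rwa [SimpleGraph.dist_eq_one_iff_adj.2 (R.adj_next z)] at this
  · have step : ∀ w, (w ∈ R.below z ↔ R.next w ∈ R.below z) ∨ w = z := by
      intro w
      by_cases hw : w = z
      · exact Or.inr hw
      · refine Or.inl ⟨?_, fun h => R.mem_below_of_iterate (i := 1) h⟩
        rintro ⟨i, hi⟩
        cases i with
        | zero => exact absurd hi hw
        | succ i => exact ⟨i, hi⟩
    have tri : ∀ a b, G.Adj a b → G.dist (R.next z) a ≤ G.dist (R.next z) b + 1 := by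
      intro a b hab
      have := R.connected.dist_triangle (u := R.next z) (v := b) (w := a)
      rwa [SimpleGraph.dist_eq_one_iff_adj.2 hab.symm] at this
    -- This potential vanishes on the subtree and equals `1 + dist (next z)` outside; the only edge
    -- between the two regions joins the values 0 and 1.
    have key := le_add_dist_of_adj R.connected
      (fun w => if w ∈ R.below z then 0 else 1 + G.dist (R.next z) w) ?_ y z
    · simp only [if_neg hy, if_pos (R.mem_below_self z)] at key
      rw [SimpleGraph.dist_comm (u := z), SimpleGraph.dist_comm (u := R.next z)] at *
      omega
    · have edge : ∀ w, (if w ∈ R.below z then 0 else 1 + G.dist (R.next z) w) ≤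
            (if R.next w ∈ R.below z then 0 else 1 + G.dist (R.next z) (R.next w)) + 1 ∧
          (if R.next w ∈ R.below z then 0 else 1 + G.dist (R.next z) (R.next w)) ≤
            (if w ∈ R.below z then 0 else 1 + G.dist (R.next z) w) + 1 := by
        intro w
        have t1 := tri _ _ (R.adj_next w)
        have t2 := tri _ _ (R.adj_next w).symm
        rcases step w with h | rfl
        · by_cases hw : w ∈ R.below z
          · simp [hw, h.1 hw]
          · simp only [hw, mt h.2 hw, if_false]
            omega
        · simp [R.mem_below_self, R.next_notMem_below hz]
      intro a b hab
      rcases (R.adj_iff a b).1 hab with rfl | rfl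
      · exact (edge a).1
      · exact (edge b).2

theorem dist_eq_of_iterate_notMem_below {z y : V} {i : ℕ} (hz : R.next^[i] z ∉ R.core)
    (hy : y ∉ R.below (R.next^[i] z)) :
    G.dist z y = i + 1 + G.dist (R.next (R.next^[i] z)) y := by
  induction i generalizing z with
  | zero => simpa using R.dist_eq_of_notMem_below (z := z) hz hy
  | succ i ih =>
    have h1 := ih (z := R.next z) hz hy
    rw [R.dist_eq_of_notMem_below (R.notMem_of_iterate hz), h1, Function.iterate_succ_apply]
    · omega
    · rintro ⟨j, hj⟩
      apply hy
      exact ⟨i + 1 + j, by rw [Function.iterate_add_apply, hj]⟩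

theorem dist_iterate_le (x : V) (i : ℕ) : G.dist x (R.next^[i] x) ≤ i := by
  induction i with
  | zero => simp
  | succ i ih =>
    have := R.connected.dist_triangle (u := x) (v := R.next^[i] x) (w := R.next^[i + 1] x)
    rw [Function.iterate_succ_apply', SimpleGraph.dist_eq_one_iff_adj.2 (R.adj_next _)] at this
    rw [Function.iterate_succ_apply']
    omega

theorem dist_proj_le (x : V) : G.dist x (R.proj x) ≤ R.depth x := R.dist_iterate_le x _

theorem dist_eq_depth_add {x y : V} (h : R.proj x ≠ R.proj y) :
    G.dist x y = R.depth x + G.dist (R.proj x) y := by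
  induction hn : R.depth x generalizing x with
  | zero =>
    rw [proj, hn, Function.iterate_zero_apply, zero_add]
  | succ n ih =>
    have hx : x ∉ R.core := fun hx => by rw [R.depth_of_mem hx] at hn; omega
    have hd := R.depth_of_notMem hx
    have hp := R.proj_next hx
    rw [R.dist_eq_of_notMem_below hx (fun hy => h (R.proj_of_mem_below hx hy).symm),
      ih (x := R.next x) (by rwa [hp]) (by omega), hp]
    omega

theorem dist_eq_depth_add_add {x y : V} (h : R.proj x ≠ R.proj y) :
    G.dist x y = R.depth x + G.dist (R.proj x) (R.proj y) + R.depth y := by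
  have hpp := R.proj_of_mem (R.proj_mem x)
  rw [R.dist_eq_depth_add h, SimpleGraph.dist_comm (u := R.proj x) (v := y),
    R.dist_eq_depth_add (x := y) (y := R.proj x) (by rw [hpp]; exact h.symm),
    SimpleGraph.dist_comm (u := R.proj x) (v := R.proj y)]
  omega

/-- Distances along the cycle. -/
theorem dist_iterate {a : V} (ha : a ∈ R.core) {i : ℕ} (hi : i < R.len) :
    G.dist (R.next^[i] a) a = min i (R.len - i) := by
  have h3 := R.three_le_len
  have inj : ∀ i < R.len, ∀ j < R.len, R.next^[i] a = R.next^[j] a → i = j := by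
    have aux : ∀ i j, i < j → j < R.len → R.next^[i] a ≠ R.next^[j] a := by
      intro i j hij hj h
      have h' := congrArg (R.next^[R.len - j]) h
      rw [← Function.iterate_add_apply, ← Function.iterate_add_apply,
        Nat.sub_add_cancel hj.le, R.iterate_len a ha] at h'
      exact R.iterate_ne a ha _ (by omega) (by omega) h'
    intro i hi j hj h
    rcases lt_trichotomy i j with hlt | heq | hlt
    · exact absurd h (aux i j hlt hj)
    · exact heq
    · exact absurd h.symm (aux j i hlt hi)
  apply le_antisymm
  · apply le_min
    · rw [SimpleGraph.dist_comm]; exact R.dist_iterate_le a i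
    · have := R.dist_iterate_le (R.next^[i] a) (R.len - i)
      rwa [← Function.iterate_add_apply, Nat.sub_add_cancel hi.le, R.iterate_len a ha] at this
  · choose! idx hidx1 hidx2 using fun b => R.exists_iterate_eq a ha b
    have hidx : ∀ j < R.len, idx (R.next^[j] a) = j := fun j hj =>
      inj _ (hidx1 _ (R.iterate_mem ha j)) _ hj (hidx2 _ (R.iterate_mem ha j))
    -- The potential is the cyclic distance of the projection from `a`; extending it constantly over
    -- the trees shows that no detour shortens a cycle distance.
    have key := le_add_dist_of_adj R.connected
      (fun w => min (idx (R.proj w)) (R.len - idx (R.proj w))) ?_ (R.next^[i] a) a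
    · have h0 := hidx 0 (by omega)
      simp only [R.proj_of_mem (R.iterate_mem ha i), R.proj_of_mem ha, hidx i hi] at key
      rw [Function.iterate_zero_apply] at h0
      rw [h0] at key
      omega
    · have edge : ∀ w, min (idx (R.proj w)) (R.len - idx (R.proj w)) ≤
            min (idx (R.proj (R.next w))) (R.len - idx (R.proj (R.next w))) + 1 ∧
          min (idx (R.proj (R.next w))) (R.len - idx (R.proj (R.next w))) ≤
            min (idx (R.proj w)) (R.len - idx (R.proj w)) + 1 := by
        intro w
        by_cases hw : w ∈ R.core
        · rw [R.proj_of_mem hw, R.proj_of_mem (R.next_mem w hw)]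
          have h1 := hidx1 w hw
          have h2 : R.next w = R.next^[idx w + 1] a := by
            rw [Function.iterate_succ_apply', hidx2 w hw]
          by_cases hl : idx w + 1 < R.len
          · have h4 : idx (R.next w) = idx w + 1 := by rw [h2]; exact hidx _ hl
            rw [h4]
            omega
          · have h4 : idx (R.next w) = 0 := by
              have h5 : idx w + 1 = R.len := by omega
              rw [h2, h5, R.iterate_len a ha]
              exact hidx 0 (by omega)
            rw [h4]
            omega
        · rw [R.proj_next hw]
          omega
      intro x y hxy
      rcases (R.adj_iff x y).1 hxy with rfl | rfl
      · exact (edge x).1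
      · exact (edge y).2

end Rooting
-- Doubly resolving sets of the cycle, and how they yield resolving sets of the graph.
namespace Rooting

variable {G : SimpleGraph V} (R : Rooting G)

theorem dist_iterate_iterate {a : V} (ha : a ∈ R.core) {i j : ℕ} (hi : i < R.len)
    (hj : j < R.len) : G.dist (R.next^[i] a) (R.next^[j] a) =
      min (max i j - min i j) (R.len - (max i j - min i j)) := by
  wlog hij : i ≤ j generalizing i j
  · rw [SimpleGraph.dist_comm, this hj hi (by omega), max_comm, min_comm j i]
  · have := R.dist_iterate (R.iterate_mem ha i) (i := j - i) (by omega)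
    rw [← Function.iterate_add_apply, Nat.sub_add_cancel hij, SimpleGraph.dist_comm] at this
    rw [this, max_eq_right hij, min_eq_left hij]

/-- A set of vertices of the cycle is doubly resolving if no two vertices of the cycle have
distances to it which differ by a constant. -/
def IsDoublyResolving (A : Set V) : Prop :=
  ∀ p ∈ R.core, ∀ q ∈ R.core, ∀ D : ℤ,
    (∀ a ∈ A, (G.dist q a : ℤ) - G.dist p a = D) → p = q

variable {R} in
theorem IsDoublyResolving.mono {A B : Set V} (h : R.IsDoublyResolving A) (hAB : A ⊆ B) :
    R.IsDoublyResolving B :=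
  fun p hp q hq D hD => h p hp q hq D fun a ha => hD a (hAB ha)

variable {R} in
-- With respect to a single landmark any difference of distances is trivially constant, so two
-- distinct cycle vertices refute double resolution.
theorem IsDoublyResolving.exists_ne {A : Set V} (h : R.IsDoublyResolving A) (c : V) :
    ∃ a ∈ A, a ≠ c := by
  by_contra! hA
  obtain ⟨n, hn⟩ := R.exists_iterate_mem c
  set p := R.next^[n] c
  refine R.next_ne p (h p hn _ (R.next_mem p hn)
    ((G.dist (R.next p) c : ℤ) - G.dist p c) fun a ha => ?_).symm
  rw [hA a ha]

/-- The distance to the first landmark minus that to the second is strictly monotone on each of the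
two arcs, in steps of two, and takes values of opposite parity on them; hence it determines the
vertex. -/
theorem isDoublyResolving_odd {a : V} (ha : a ∈ R.core) {h : ℕ} (hlen : R.len = 2 * h + 1) :
    R.IsDoublyResolving {a, R.next^[h] a} := by
  intro p hp q hq D hD
  have h3 := R.three_le_len
  obtain ⟨i, hi, rfl⟩ := R.exists_iterate_eq a ha p hp
  obtain ⟨j, hj, rfl⟩ := R.exists_iterate_eq a ha q hq
  have h1 := hD a (by simp)
  have h2 := hD (R.next^[h] a) (by simp)
  rw [R.dist_iterate ha hi, R.dist_iterate ha hj] at h1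
  rw [R.dist_iterate_iterate ha hi (by omega), R.dist_iterate_iterate ha hj (by omega)] at h2
  have : i = j := by omega
  rw [this]

theorem isDoublyResolving_even {a : V} (ha : a ∈ R.core) {h : ℕ} (hlen : R.len = 2 * h)
    {e : V} (he : e ∈ R.core) (hea : e ≠ a) (heh : e ≠ R.next^[h] a) :
    R.IsDoublyResolving {a, R.next^[h] a, e} := by
  intro p hp q hq D hD
  have h3 := R.three_le_len
  obtain ⟨i, hi, rfl⟩ := R.exists_iterate_eq a ha p hp
  obtain ⟨j, hj, rfl⟩ := R.exists_iterate_eq a ha q hq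
  obtain ⟨k, hk, rfl⟩ := R.exists_iterate_eq a ha e he
  have hk0 : k ≠ 0 := by rintro rfl; exact hea rfl
  have hkh : k ≠ h := by rintro rfl; exact heh rfl
  have h1 := hD a (by simp)
  have h2 := hD (R.next^[h] a) (by simp)
  have h4 := hD (R.next^[k] a) (by simp)
  rw [R.dist_iterate ha hi, R.dist_iterate ha hj] at h1
  rw [R.dist_iterate_iterate ha hi (by omega), R.dist_iterate_iterate ha hj (by omega)] at h2 h4
  rw [hlen] at *
  -- The distances to two antipodes always add up to `h`, so `D = 0`, and the vertices agree up to
  -- reflection in the axis through `a`. The landmark `e` off this axis decides.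
  have hij : D = 0 ∧ (i = j ∨ i + j = 2 * h) := by
    clear h4
    rcases le_total i h with hih | hih <;> rcases le_total j h with hjh | hjh <;> omega
  obtain ⟨rfl, rfl | h5⟩ := hij
  · rfl
  · obtain rfl : j = 2 * h - i := by omega
    clear h1 h2 hD
    have : i = h := by
      rcases le_total i k with hik | hik <;> rcases le_total (2 * h - i) k with hjk | hjk <;> omega
    rw [this, two_mul, Nat.add_sub_cancel]

theorem iterate_ne_iterate {a : V} (ha : a ∈ R.core) {i j : ℕ} (hij : i < j)
    (hj : j - i < R.len) : R.next^[i] a ≠ R.next^[j] a := by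
  intro h
  have h1 := R.iterate_ne _ (R.iterate_mem ha i) (j - i) hj (by omega)
  rw [← Function.iterate_add_apply, Nat.sub_add_cancel hij.le] at h1
  exact h1 h.symm

/-- Two vertices of the cycle extend to a doubly resolving set by one vertex, which can be chosen
different from any given vertex. -/
theorem exists_isDoublyResolving {a b : V} (ha : a ∈ R.core) (hb : b ∈ R.core) (hab : a ≠ b)
    (v : V) : ∃ c ∈ R.core, c ≠ v ∧ R.IsDoublyResolving {a, b, c} := by
  have h3 := R.three_le_len
  rcases Nat.even_or_odd' R.len with ⟨h, hlen | hlen⟩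
  · have anti : ∀ x ∈ R.core, R.next^[h] (R.next^[h] x) = x := by
      intro x hx
      rw [← Function.iterate_add_apply, ← two_mul, ← hlen, R.iterate_len x hx]
    -- If `a` and `b` are antipodal, either neighbour of `a` lies off their axis, and one of them is
    -- not `v`. Otherwise the antipode of `a` or that of `b` serves; these differ, so one is not
    -- `v`.
    by_cases hbh : b = R.next^[h] a
    · have hne : R.next^[1] a ≠ R.next^[R.len - 1] a :=
        R.iterate_ne_iterate ha (by omega) (by omega)
      obtain ⟨i, hi0, hih, hil, hiv⟩ :
          ∃ i, 0 < i ∧ i ≠ h ∧ i < R.len ∧ R.next^[i] a ≠ v := by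
        by_cases hv : R.next^[1] a = v
        · exact ⟨R.len - 1, by omega, by omega, by omega, by rw [← hv]; exact hne.symm⟩
        · exact ⟨1, by omega, by omega, by omega, hv⟩
      refine ⟨R.next^[i] a, R.iterate_mem ha i, hiv, ?_⟩
      rw [hbh]
      refine R.isDoublyResolving_even ha hlen (R.iterate_mem ha i) (R.iterate_ne a ha i hil hi0) ?_
      rcases lt_or_gt_of_ne hih with hlt | hlt
      · exact R.iterate_ne_iterate ha hlt (by omega)
      · exact (R.iterate_ne_iterate ha hlt (by omega)).symm
    · by_cases hv : R.next^[h] a = v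
      · refine ⟨R.next^[h] b, R.iterate_mem hb h, ?_, ?_⟩
        · intro h'
          apply hab
          rw [← anti a ha, ← anti b hb, h', hv]
        · refine (R.isDoublyResolving_even hb hlen ha hab ?_).mono ?_
          · intro h'
            exact hbh (by rw [h', anti b hb])
          · intro x; simp only [Set.mem_insert_iff, Set.mem_singleton_iff]; tauto
      · refine ⟨R.next^[h] a, R.iterate_mem ha h, hv, ?_⟩
        refine (R.isDoublyResolving_even ha hlen hb hab.symm hbh).mono ?_
        intro x; simp only [Set.mem_insert_iff, Set.mem_singleton_iff]; tauto
  -- On an odd cycle either of the two vertices farthest from `a` works, and one of them is not `v`.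
  · by_cases hv : R.next^[h] a = v
    · refine ⟨R.next^[h + 1] a, R.iterate_mem ha _, ?_, ?_⟩
      · rw [← hv]
        exact (R.iterate_ne_iterate ha (Nat.lt_succ_self h) (by omega)).symm
      · refine (R.isDoublyResolving_odd (R.iterate_mem ha (h + 1)) hlen).mono ?_
        rw [← Function.iterate_add_apply, show h + (h + 1) = R.len by omega, R.iterate_len a ha]
        intro x; simp only [Set.mem_insert_iff, Set.mem_singleton_iff]; tauto
    · refine ⟨R.next^[h] a, R.iterate_mem ha h, hv, ?_⟩
      refine (R.isDoublyResolving_odd ha hlen).mono ?_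
      intro x; simp only [Set.mem_insert_iff, Set.mem_singleton_iff]; tauto

/-- A set with a vertex below one of any two siblings off the cycle, and whose projection to the
cycle is doubly resolving, is resolving. -/
theorem isResolving_of_isDoublyResolving {S : Finset V} {A : Set V} (hA : R.IsDoublyResolving A)
    (hAS : ∀ a ∈ A, ∃ s ∈ S, R.proj s = a)
    (hS : ∀ x y, x ∉ R.core → y ∉ R.core → x ≠ y → R.next x = R.next y →
      ∃ s ∈ S, s ∈ R.below x ∨ s ∈ R.below y) : IsResolving G S := by
  intro x y hxy
  by_cases hp : R.proj x = R.proj y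
  · by_cases hd : R.depth x = R.depth y
    · have hex : ∃ i, R.next^[i] x = R.next^[i] y :=
        ⟨R.depth x, by have h := hp; rw [proj, proj, ← hd] at h; exact h⟩
      -- Just before the orbits merge they pass through two siblings; a landmark below one sibling
      -- is closer to the vertex below that same sibling.
      obtain ⟨i, hi, hi1⟩ : ∃ i, R.next^[i] x ≠ R.next^[i] y ∧
          R.next^[i + 1] x = R.next^[i + 1] y := by
        by_contra! hcon
        obtain ⟨n, hn⟩ := hex
        have : ∀ n, R.next^[n] x ≠ R.next^[n] y := by
          intro n
          induction n with
          | zero => exact hxy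
          | succ n ih => exact hcon n ih
        exact this n hn
      have hil : i < R.depth x := by
        by_contra! hle
        apply hi
        have h1 : R.next^[R.depth x] x = R.next^[R.depth x] y := by
          have h := hp; rw [proj, proj, ← hd] at h; exact h
        rw [← Nat.sub_add_cancel hle, Function.iterate_add_apply, Function.iterate_add_apply, h1]
      have hx' := R.iterate_notMem hil
      have hy' := R.iterate_notMem (x := y) (i := i) (by omega)
      rw [Function.iterate_succ_apply', Function.iterate_succ_apply'] at hi1
      have main : ∀ x y s, R.next^[i] x ∉ R.core → R.next^[i] y ∉ R.core →
          R.next^[i] x ≠ R.next^[i] y → R.next (R.next^[i] x) = R.next (R.next^[i] y) →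
          s ∈ R.below (R.next^[i] x) → G.dist x s < G.dist y s := by
        intro x y s hx' hy' hi hi1 hs
        have hs' := R.notMem_below_of_sibling hx' hy' hi hi1 hs
        rw [R.dist_eq_of_iterate_notMem_below hy' hs', ← hi1]
        obtain ⟨j, hj⟩ := hs
        have h1 := R.dist_iterate_le x i
        have h2 := R.dist_iterate_le s j
        have h3 := R.dist_eq_of_iterate_notMem_below (z := s) (i := j)
          (y := R.next (R.next^[i] x)) (by rwa [hj]) (by rw [hj]; exact R.next_notMem_below hx')
        rw [hj, SimpleGraph.dist_self] at h3
        rw [hj] at h2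
        have h4 := R.connected.dist_triangle (u := x) (v := R.next^[i] x) (w := s)
        rw [SimpleGraph.dist_comm (u := R.next^[i] x)] at h4
        rw [SimpleGraph.dist_comm (u := R.next (R.next^[i] x)), h3]
        omega
      obtain ⟨s, hsS, hs | hs⟩ := hS _ _ hx' hy' hi hi1
      · exact ⟨s, hsS, (main x y s hx' hy' hi hi1 hs).ne⟩
      · exact ⟨s, hsS, (main y x s hy' hx' hi.symm hi1.symm hs).ne'⟩
    -- A landmark in another tree sees the difference of depths.
    · obtain ⟨a, haA, ha⟩ := hA.exists_ne (R.proj x)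
      obtain ⟨s, hsS, rfl⟩ := hAS a haA
      refine ⟨s, hsS, ?_⟩
      rw [R.dist_eq_depth_add_add (Ne.symm ha),
        R.dist_eq_depth_add_add (x := y) (by rw [← hp]; exact ha.symm), hp]
      omega
  · by_contra! hcon
    wlog hle : R.depth y ≤ R.depth x generalizing x y
    · exact this y x hxy.symm (Ne.symm hp) (fun s hs => (hcon s hs).symm) (by omega)
    have tri : ∀ s, G.dist x s ≤ R.depth x + G.dist (R.proj x) (R.proj s) + R.depth s := by
      intro s
      have h1 := R.dist_proj_le x
      have h2 := R.dist_proj_le s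
      rw [SimpleGraph.dist_comm] at h2
      have h3 := R.connected.dist_triangle (u := x) (v := R.proj x) (w := s)
      have h4 := R.connected.dist_triangle (u := R.proj x) (v := R.proj s) (w := s)
      omega
    have tri' : ∀ s, G.dist y s ≤ R.depth y + G.dist (R.proj y) (R.proj s) + R.depth s := by
      intro s
      have h1 := R.dist_proj_le y
      have h2 := R.dist_proj_le s
      rw [SimpleGraph.dist_comm] at h2
      have h3 := R.connected.dist_triangle (u := y) (v := R.proj y) (w := s)
      have h4 := R.connected.dist_triangle (u := R.proj y) (v := R.proj s) (w := s)
      omega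
    have hpq : 0 < G.dist (R.proj x) (R.proj y) := R.connected.pos_dist_of_ne hp
    -- A landmark in the tree of `y` would be strictly closer to `y`, since `x` is at least as deep
    -- and must also travel along the cycle.
    have haq : ∀ a ∈ A, a ≠ R.proj y := by
      rintro a ha rfl
      obtain ⟨s, hsS, hs⟩ := hAS _ ha
      have h1 := hcon s hsS
      have h2 := tri' s
      rw [R.dist_eq_depth_add_add (x := x) (y := s) (by rw [hs]; exact hp), hs] at h1
      rw [hs, SimpleGraph.dist_self] at h2
      omega
    have haD : ∀ a ∈ A, a ≠ R.proj x →
        R.depth x + G.dist (R.proj x) a = R.depth y + G.dist (R.proj y) a := by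
      intro a ha hap
      obtain ⟨s, hsS, rfl⟩ := hAS a ha
      have h1 := hcon s hsS
      rw [R.dist_eq_depth_add_add (Ne.symm hap), R.dist_eq_depth_add_add (haq _ ha).symm] at h1
      omega
    -- Landmarks outside the tree of `x` give the constant difference `depth x - depth y`. If there
    -- is also a landmark in that tree, its equation forces this constant to be at least the
    -- distance of the projections, and the triangle inequality gives the reverse, so `A` still sees
    -- one constant.
    by_cases hpA : R.proj x ∈ A
    · have h1 : R.depth y + G.dist (R.proj y) (R.proj x) ≤ R.depth x := by
        obtain ⟨s, hsS, hs⟩ := hAS (R.proj x) hpA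
        have h1 := hcon s hsS
        have h2 := tri s
        rw [R.dist_eq_depth_add_add (x := y) (y := s) (by rw [hs]; exact Ne.symm hp), hs] at h1
        rw [hs, SimpleGraph.dist_self] at h2
        omega
      refine hp (hA _ (R.proj_mem x) _ (R.proj_mem y) (G.dist (R.proj y) (R.proj x))
        fun a ha => ?_)
      by_cases hap : a = R.proj x
      · simp [hap]
      · have h2 := haD a ha hap
        obtain ⟨a', ha', hap'⟩ := hA.exists_ne (R.proj x)
        have h3 := haD a' ha' hap'
        have h4 := R.connected.dist_triangle (u := R.proj y) (v := R.proj x) (w := a)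
        omega
    · refine hp (hA _ (R.proj_mem x) _ (R.proj_mem y) ((R.depth x : ℤ) - R.depth y)
        fun a ha => ?_)
      have h2 := haD a ha (by rintro rfl; exact hpA ha)
      omega

end Rooting
-- Degrees, branching vertices and threads in terms of `next`.
namespace Rooting

variable {G : SimpleGraph V} (R : Rooting G)

theorem exists_isPath_iterate {x v : V} {n : ℕ} (hv : R.next^[n] x = v)
    (h : ∀ i < n, R.next^[i] x ∉ R.core) :
    ∃ p : G.Walk x v, p.IsPath ∧ ∀ y ∈ p.support, ∃ i ≤ n, R.next^[i] x = y := by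
  induction n generalizing x with
  | zero =>
    obtain rfl : x = v := hv
    refine ⟨.nil, .nil, fun y hy => ⟨0, le_rfl, ?_⟩⟩
    rw [SimpleGraph.Walk.support_nil, List.mem_singleton] at hy
    exact hy.symm
  | succ n ih =>
    obtain ⟨p, hp, hsup⟩ := ih (x := R.next x) hv fun i hi => h (i + 1) (by omega)
    refine ⟨.cons (R.adj_next x) p, ?_, ?_⟩
    · rw [SimpleGraph.Walk.cons_isPath_iff]
      refine ⟨hp, fun hx => ?_⟩
      obtain ⟨i, -, hi⟩ := hsup x hx
      exact R.next_notMem_below (h 0 (by omega)) ⟨i, hi⟩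
    · intro y hy
      rw [SimpleGraph.Walk.support_cons, List.mem_cons] at hy
      rcases hy with rfl | hy
      · exact ⟨0, by omega, rfl⟩
      · obtain ⟨i, hi, rfl⟩ := hsup y hy
        exact ⟨i + 1, by omega, rfl⟩

variable [Fintype V]

open Classical in
/-- The vertices mapped to `x` by `next`. -/
noncomputable def children (x : V) : Finset V := {y | R.next y = x}

@[simp] theorem mem_children {x y : V} : y ∈ R.children x ↔ R.next y = x := by
  simp [children]

variable [DecidableRel G.Adj]

theorem degree_eq (x : V) : G.degree x = (R.children x).card + 1 := by
  classical
  have : G.neighborFinset x = insert (R.next x) (R.children x) := by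
    ext y
    simp only [SimpleGraph.mem_neighborFinset, R.adj_iff, Finset.mem_insert, mem_children]
    tauto
  rw [← SimpleGraph.card_neighborFinset_eq_degree, this, Finset.card_insert_of_notMem]
  simpa using R.next_next_ne x

theorem degree_eq_one_iff {x : V} : G.degree x = 1 ↔ ∀ y, R.next y ≠ x := by
  rw [R.degree_eq, Nat.add_eq_right, Finset.card_eq_zero, Finset.eq_empty_iff_forall_notMem]
  simp

theorem three_le_degree_iff {x : V} :
    3 ≤ G.degree x ↔ ∃ y z, y ≠ z ∧ R.next y = x ∧ R.next z = x := by
  rw [R.degree_eq, show 3 ≤ (R.children x).card + 1 ↔ 1 < (R.children x).card by omega,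
    Finset.one_lt_card]
  simp only [mem_children]
  exact ⟨fun ⟨y, hy, z, hz, h⟩ => ⟨y, z, h, hy, hz⟩, fun ⟨y, z, h, hy, hz⟩ => ⟨y, hy, z, hz, h⟩⟩

theorem four_le_degree_iff {x : V} (hx : x ∈ R.core) : 4 ≤ G.degree x ↔
    ∃ y z, y ≠ z ∧ y ∉ R.core ∧ z ∉ R.core ∧ R.next y = x ∧ R.next z = x := by
  classical
  obtain ⟨e, he, hex⟩ := R.exists_core_child hx
  have hc : (R.children x).card = ((R.children x).erase e).card + 1 :=
    (Finset.card_erase_add_one (by simpa using hex)).symm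
  rw [R.degree_eq, hc, show 4 ≤ ((R.children x).erase e).card + 1 + 1 ↔
    1 < ((R.children x).erase e).card by omega, Finset.one_lt_card]
  have hmem : ∀ y, y ∈ (R.children x).erase e ↔ y ∉ R.core ∧ R.next y = x := by
    intro y
    rw [Finset.mem_erase, mem_children]
    constructor
    · rintro ⟨h1, h2⟩
      exact ⟨fun h => h1 (R.core_child_unique h he (h2.trans hex.symm)), h2⟩
    · rintro ⟨h1, h2⟩
      exact ⟨by rintro rfl; exact h1 he, h2⟩
  simp only [hmem]
  exact ⟨fun ⟨y, hy, z, hz, h⟩ => ⟨y, z, h, hy.1, hz.1, hy.2, hz.2⟩,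
    fun ⟨y, z, h, hy, hz, hy', hz'⟩ => ⟨y, ⟨hy, hy'⟩, z, ⟨hz, hz'⟩, h⟩⟩

/-- A cycle vertex has one extra child, its predecessor on the cycle. Discounting it unifies the two
degree thresholds: branching means having two children off the cycle. -/
theorem isBranching_iff (hcore : cycleVerts G = R.core) {x : V} : IsBranching G x ↔
    ∃ y z, y ≠ z ∧ y ∉ R.core ∧ z ∉ R.core ∧ R.next y = x ∧ R.next z = x := by
  rw [IsBranching, hcore]
  by_cases hx : x ∈ R.core
  · simp only [hx, not_true_eq_false, false_and, or_false, true_and]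
    exact R.four_le_degree_iff hx
  · simp only [hx, not_false_eq_true, false_and, false_or, true_and]
    rw [R.three_le_degree_iff]
    have aux : ∀ y, R.next y = x → y ∉ R.core := by
      rintro y rfl hy
      exact hx (R.next_mem y hy)
    exact ⟨fun ⟨y, z, h, hy, hz⟩ => ⟨y, z, h, aux y hy, aux z hz, hy, hz⟩,
      fun ⟨y, z, h, _, _, hy, hz⟩ => ⟨y, z, h, hy, hz⟩⟩

theorem child_unique {x y z : V} (h : ¬ 3 ≤ G.degree x) (hy : R.next y = x) (hz : R.next z = x) :
    y = z := by
  by_contra hyz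
  exact h (R.three_le_degree_iff.2 ⟨y, z, hyz, hy, hz⟩)

theorem notMem_core_of_degree_eq_one {u : V} (hu : G.degree u = 1) : u ∉ R.core := by
  intro h
  obtain ⟨e, -, he⟩ := R.exists_core_child h
  exact R.degree_eq_one_iff.1 hu e he

/-- Guarantees that the infimum defining `headIndex` is over a nonempty set and is reached no later
than the cycle. -/
theorem three_le_degree_proj {u : V} (hu : u ∉ R.core) : 3 ≤ G.degree (R.proj u) := by
  obtain ⟨d, hd⟩ : ∃ d, R.depth u = d + 1 := ⟨_, R.depth_of_notMem hu⟩
  obtain ⟨e, he, heq⟩ := R.exists_core_child (R.proj_mem u)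
  refine R.three_le_degree_iff.2 ⟨R.next^[d] u, e, ?_, ?_, heq⟩
  · rintro rfl
    exact R.iterate_notMem (by omega) he
  · rw [proj, hd, Function.iterate_succ_apply']

/-- The number of steps from `u` towards the cycle to the first vertex of degree at least three. -/
noncomputable def headIndex (u : V) : ℕ := sInf {k | 3 ≤ G.degree (R.next^[k] u)}

/-- The vertex to which the thread ending in the leaf `u` is attached. -/
noncomputable def head (u : V) : V := R.next^[R.headIndex u] u

/-- The first vertex of the thread ending in the leaf `u`. -/
noncomputable def top (u : V) : V := R.next^[R.headIndex u - 1] u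

theorem not_three_le_degree_iterate {u : V} {i : ℕ} (hi : i < R.headIndex u) :
    ¬ 3 ≤ G.degree (R.next^[i] u) := fun h => Nat.notMem_of_lt_sInf hi h

theorem headIndex_le_depth {u : V} (hu : u ∉ R.core) : R.headIndex u ≤ R.depth u :=
  Nat.sInf_le (R.three_le_degree_proj hu)

theorem three_le_degree_head {u : V} (hu : u ∉ R.core) : 3 ≤ G.degree (R.head u) :=
  Nat.sInf_mem (s := {k | 3 ≤ G.degree (R.next^[k] u)}) ⟨_, R.three_le_degree_proj hu⟩

theorem headIndex_eq {u : V} {k : ℕ} (h1 : 3 ≤ G.degree (R.next^[k] u))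
    (h2 : ∀ i < k, ¬ 3 ≤ G.degree (R.next^[i] u)) : R.headIndex u = k := by
  apply le_antisymm (Nat.sInf_le (s := {k | 3 ≤ G.degree (R.next^[k] u)}) h1)
  by_contra! hlt
  exact h2 _ hlt (Nat.sInf_mem (s := {k | 3 ≤ G.degree (R.next^[k] u)}) ⟨_, h1⟩)

/-- Makes the truncated subtraction in `top` a genuine one. -/
theorem headIndex_pos {u : V} (hu : G.degree u = 1) : 0 < R.headIndex u := by
  by_contra! h
  have h1 := R.three_le_degree_head (R.notMem_core_of_degree_eq_one hu)
  rw [head, Nat.le_zero.1 h, Function.iterate_zero_apply] at h1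
  omega

theorem next_top {u : V} (hu : G.degree u = 1) : R.next (R.top u) = R.head u := by
  have := R.headIndex_pos hu
  rw [top, head, ← Function.iterate_succ_apply' R.next, Nat.succ_eq_add_one,
    Nat.sub_add_cancel this]

theorem top_notMem {u : V} (hu : G.degree u = 1) : R.top u ∉ R.core := by
  have h1 := R.headIndex_pos hu
  have h2 := R.headIndex_le_depth (R.notMem_core_of_degree_eq_one hu)
  exact R.iterate_notMem (by omega)

theorem mem_below_top (u : V) : u ∈ R.below (R.top u) := ⟨_, rfl⟩

/-- Descending from `top u`, every vertex has degree below three and hence at most one child, so the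
descent retraces the thread. -/
theorem eq_iterate_of_mem_below_top {u y : V} (hu : G.degree u = 1) (hy : y ∈ R.below (R.top u)) :
    ∃ i < R.headIndex u, R.next^[i] u = y := by
  have h1 := R.headIndex_pos hu
  have key : ∀ j i y, i < R.headIndex u → R.next^[j] y = R.next^[i] u →
      ∃ i < R.headIndex u, R.next^[i] u = y := by
    intro j
    induction j with
    | zero => exact fun i y hi h => ⟨i, hi, h.symm⟩
    | succ j ih =>
      intro i y hi h
      rw [Function.iterate_succ_apply'] at h
      cases i with
      | zero => exact absurd h (R.degree_eq_one_iff.1 hu _)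
      | succ i =>
        refine ih i y (by omega) ?_
        apply R.child_unique (R.not_three_le_degree_iterate hi) h
        rw [Function.iterate_succ_apply']
  obtain ⟨j, hj⟩ := hy
  exact key j _ y (by omega) hj

/-- Distinct threads are disjoint: a leaf has no children, so it can only be the starting point of
another leaf's orbit. -/
theorem eq_of_mem_below_top {u w s : V} (hu : G.degree u = 1) (hw : G.degree w = 1)
    (hsu : s ∈ R.below (R.top u)) (hsw : s ∈ R.below (R.top w)) : u = w := by
  obtain ⟨i, -, rfl⟩ := R.eq_iterate_of_mem_below_top hu hsu
  obtain ⟨j, -, hj⟩ := R.eq_iterate_of_mem_below_top hw (R.mem_below_of_iterate hsw)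
  cases j with
  | zero => exact hj.symm
  | succ j =>
    rw [Function.iterate_succ_apply'] at hj
    exact absurd hj (R.degree_eq_one_iff.1 hu _)

/-- A path that begins by going up cannot turn down at a vertex of degree below three: its only
child is the vertex just left. -/
theorem eq_iterate_of_walk {x v : V} (q : G.Walk x v) (hq : q.IsPath)
    (hdeg : ∀ y ∈ q.support, y ≠ v → ¬ 3 ≤ G.degree y)
    (hx : ∀ z, R.next z = x → z ∉ q.support) :
    ∃ j, R.next^[j] x = v ∧ ∀ i < j, ¬ 3 ≤ G.degree (R.next^[i] x) := by
  induction q with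
  | nil => exact ⟨0, rfl, fun i hi => absurd hi (by omega)⟩
  | @cons x y v hadj p ih =>
    rw [SimpleGraph.Walk.cons_isPath_iff] at hq
    have hxv : x ≠ v := by
      rintro rfl
      exact hq.2 p.end_mem_support
    have hxd : ¬ 3 ≤ G.degree x := hdeg x (by simp) hxv
    have hxy : R.next x = y := by
      rcases (R.adj_iff x y).1 hadj with h | h
      · exact h
      · exact absurd (by simp) (hx y h)
    by_cases hyv : y = v
    · subst hyv
      refine ⟨1, hxy, fun i hi => ?_⟩
      obtain rfl : i = 0 := by omega
      exact hxd
    · have hyd : ¬ 3 ≤ G.degree y := hdeg y (by simp) hyv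
      obtain ⟨j, hj, hji⟩ := ih hq.1
        (fun z hz hzv => hdeg z (by simp [hz]) hzv)
        (fun z hz hzp => by rw [R.child_unique hyd hz hxy] at hzp; exact hq.2 hzp)
      refine ⟨j + 1, by rw [Function.iterate_succ_apply, hxy, hj], fun i hi => ?_⟩
      cases i with
      | zero => exact hxd
      | succ i =>
        rw [Function.iterate_succ_apply, hxy]
        exact hji i (by omega)

theorem exists_isThread_iff {u v : V} :
    (∃ p : G.Walk v u, IsThread G p) ↔ G.degree u = 1 ∧ R.head u = v := by
  constructor
  · rintro ⟨p, hv, hp, hu, hmid⟩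
    refine ⟨hu, ?_⟩
    obtain ⟨j, hj, hji⟩ := R.eq_iterate_of_walk p.reverse hp.reverse
      (fun y hy hyv => by
        rw [SimpleGraph.Walk.support_reverse, List.mem_reverse] at hy
        by_cases hyu : y = u
        · rw [hyu]; omega
        · rw [hmid y hy hyv hyu]; omega)
      (fun z hz => absurd hz (R.degree_eq_one_iff.1 hu z))
    rw [head, R.headIndex_eq (by rwa [hj]) hji, hj]
  · rintro ⟨hu, rfl⟩
    have huc := R.notMem_core_of_degree_eq_one hu
    have hle := R.headIndex_le_depth huc
    obtain ⟨p, hp, hsup⟩ := R.exists_isPath_iterate (v := R.head u) rfl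
      fun i hi => R.iterate_notMem (by omega)
    refine ⟨p.reverse, R.three_le_degree_head huc, hp.reverse, hu, fun x hx hxv hxu => ?_⟩
    rw [SimpleGraph.Walk.support_reverse, List.mem_reverse] at hx
    obtain ⟨i, hi, rfl⟩ := hsup x hx
    have hi' : i < R.headIndex u := lt_of_le_of_ne hi (by rintro rfl; exact hxv rfl)
    have h3 := R.not_three_le_degree_iterate hi'
    have h1 := R.degree_eq (R.next^[i] u)
    have h2 : G.degree (R.next^[i] u) ≠ 1 := by
      intro h
      cases i with
      | zero => exact hxu rfl
      | succ i => exact R.degree_eq_one_iff.1 h _ (Function.iterate_succ_apply' R.next i u).symm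
    omega

/-- Below a vertex off the cycle there is a vertex of any set `S` missing at most one of the leaves
with the same head, or else there is a leaf whose thread contains the vertex. -/
theorem exists_mem_or_thread {S : Finset V}
    (hS : ∀ u w, G.degree u = 1 → G.degree w = 1 → u ≠ w → R.head u = R.head w → u ∈ S ∨ w ∈ S)
    {z : V} (hz : z ∉ R.core) : (∃ s ∈ S, s ∈ R.below z) ∨
      ∃ u i, G.degree u = 1 ∧ R.next^[i] u = z ∧ ∀ j ≤ i, ¬ 3 ≤ G.degree (R.next^[j] u) := by
  obtain ⟨N, hN⟩ : ∃ N, ∀ x, R.depth x ≤ N :=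
    ⟨Finset.univ.sup R.depth, fun x => Finset.le_sup (Finset.mem_univ x)⟩
  -- Induction from the deepest vertices towards the cycle.
  induction hn : N - R.depth z using Nat.strong_induction_on generalizing z with
  | _ n ih =>
    have child : ∀ r, R.next r = z → (∃ s ∈ S, s ∈ R.below z) ∨
        ∃ u i, G.degree u = 1 ∧ R.next^[i] u = r ∧ ∀ j ≤ i, ¬ 3 ≤ G.degree (R.next^[j] u) := by
      intro r hr
      have hrc : r ∉ R.core := fun h => hz (hr ▸ R.next_mem r h)
      have hd := R.depth_of_notMem hrc
      have hNr := hN r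
      rw [hr] at hd
      rcases ih (N - R.depth r) (by omega) hrc rfl with ⟨s, hs, hsr⟩ | h
      · obtain ⟨i, rfl⟩ := hsr
        exact Or.inl ⟨s, hs, i + 1, by rw [Function.iterate_succ_apply', hr]⟩
      · exact Or.inr h
    by_cases h3 : 3 ≤ G.degree z
    -- Were both child subtrees bare threads, their two leaves would share the head `z`, and one of
    -- them would be in `S`.
    · obtain ⟨r, r', hrr, hr, hr'⟩ := R.three_le_degree_iff.1 h3
      rcases child r hr with h | ⟨u, i, hu, hi, hji⟩
      · exact Or.inl h
      rcases child r' hr' with h | ⟨w, j, hw, hj, hjj⟩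
      · exact Or.inl h
      have hiu : R.headIndex u = i + 1 :=
        R.headIndex_eq (by rwa [Function.iterate_succ_apply', hi, hr])
          fun k hk => hji k (by omega)
      have hjw : R.headIndex w = j + 1 :=
        R.headIndex_eq (by rwa [Function.iterate_succ_apply', hj, hr'])
          fun k hk => hjj k (by omega)
      have hhu : R.head u = z := by rw [head, hiu, Function.iterate_succ_apply', hi, hr]
      have hhw : R.head w = z := by rw [head, hjw, Function.iterate_succ_apply', hj, hr']
      have huw : u ≠ w := by
        rintro rfl
        obtain rfl : i = j := by omega
        exact hrr (hi.symm.trans hj)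
      rcases hS u w hu hw huw (hhu.trans hhw.symm) with h | h
      · exact Or.inl ⟨u, h, i + 1, by rw [Function.iterate_succ_apply', hi, hr]⟩
      · exact Or.inl ⟨w, h, j + 1, by rw [Function.iterate_succ_apply', hj, hr']⟩
    · by_cases h1 : G.degree z = 1
      · refine Or.inr ⟨z, 0, h1, rfl, fun j hj => ?_⟩
        rw [Nat.le_zero.1 hj]
        exact h3
      · rw [R.degree_eq_one_iff] at h1
        push Not at h1
        obtain ⟨r, hr⟩ := h1
        rcases child r hr with h | ⟨u, i, hu, hi, hji⟩
        · exact Or.inl h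
        · refine Or.inr ⟨u, i + 1, hu, by rw [Function.iterate_succ_apply', hi, hr], fun j hj => ?_⟩
          rcases Nat.lt_or_ge j (i + 1) with hlt | hge
          · exact hji j (by omega)
          · obtain rfl : j = i + 1 := by omega
            rwa [Function.iterate_succ_apply', hi, hr]

/-- If `S` missed both subtrees, each would contain a thread hanging from the common parent, and `S`
contains the end of one of these two threads. -/
theorem exists_mem_below_of_sibling {S : Finset V}
    (hS : ∀ u w, G.degree u = 1 → G.degree w = 1 → u ≠ w → R.head u = R.head w → u ∈ S ∨ w ∈ S)
    {x y : V} (hx : x ∉ R.core) (hy : y ∉ R.core) (hxy : x ≠ y) (h : R.next x = R.next y) :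
    ∃ s ∈ S, s ∈ R.below x ∨ s ∈ R.below y := by
  have h3 : 3 ≤ G.degree (R.next y) := R.three_le_degree_iff.2 ⟨x, y, hxy, h, rfl⟩
  rcases R.exists_mem_or_thread hS hx with ⟨s, hs, hsx⟩ | ⟨u, i, hu, hi, hji⟩
  · exact ⟨s, hs, Or.inl hsx⟩
  rcases R.exists_mem_or_thread hS hy with ⟨s, hs, hsy⟩ | ⟨w, j, hw, hj, hjj⟩
  · exact ⟨s, hs, Or.inr hsy⟩
  have hhu : R.head u = R.next y := by
    rw [head, R.headIndex_eq (k := i + 1) (by rwa [Function.iterate_succ_apply', hi, h])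
      fun k hk => hji k (by omega), Function.iterate_succ_apply', hi, h]
  have hhw : R.head w = R.next y := by
    rw [head, R.headIndex_eq (k := j + 1) (by rwa [Function.iterate_succ_apply', hj])
      fun k hk => hjj k (by omega), Function.iterate_succ_apply', hj]
  have huw : u ≠ w := by
    rintro rfl
    exact R.notMem_below_of_sibling hx hy hxy h ⟨i, hi⟩ ⟨j, hj⟩
  rcases hS u w hu hw huw (hhu.trans hhw.symm) with h' | h'
  · exact ⟨u, h', Or.inl ⟨i, hi⟩⟩
  · exact ⟨w, h', Or.inr ⟨j, hj⟩⟩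

end Rooting
-- Construction of the rooting of a unicyclic graph.
theorem mem_cycleVerts_iff {G : SimpleGraph V} {u : V} {w : G.Walk u u} (hw : w.IsCycle)
    (huniq : ∀ C, IsCycleSubgraph G C → C = w.toSubgraph) {x : V} :
    x ∈ cycleVerts G ↔ x ∈ w.support := by
  constructor
  · rintro ⟨C, hC, hx⟩
    rwa [huniq C hC, SimpleGraph.Walk.mem_verts_toSubgraph] at hx
  · exact fun hx => ⟨_, ⟨u, w, hw, rfl⟩, by rwa [SimpleGraph.Walk.mem_verts_toSubgraph]⟩

theorem mem_cycleEdges_iff {G : SimpleGraph V} {u : V} {w : G.Walk u u} (hw : w.IsCycle)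
    (huniq : ∀ C, IsCycleSubgraph G C → C = w.toSubgraph) {e : Sym2 V} :
    e ∈ cycleEdges G ↔ e ∈ w.edges := by
  constructor
  · rintro ⟨C, hC, he⟩
    rwa [huniq C hC, SimpleGraph.Walk.mem_edges_toSubgraph] at he
  · exact fun he => ⟨_, ⟨u, w, hw, rfl⟩, by rwa [SimpleGraph.Walk.mem_edges_toSubgraph]⟩

/-- A unicyclic graph has as many edges as vertices. -/
theorem IsUnicyclic.card_edgeFinset [Fintype V] {G : SimpleGraph V} [Fintype G.edgeSet]
    (hG : IsUnicyclic G) : G.edgeFinset.card = Fintype.card V := by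
  classical
  obtain ⟨hconn, C, ⟨u, w, hw, rfl⟩, huniq⟩ := hG
  obtain ⟨e, he⟩ : ∃ e, e ∈ w.edges := by
    apply List.exists_mem_of_ne_nil
    intro h
    have h1 := hw.three_le_length
    rw [← SimpleGraph.Walk.length_edges, h] at h1
    simp at h1
  have heG : e ∈ G.edgeSet := w.edges_subset_edgeSet he
  have hH : (G.deleteEdges {e}).Connected := by
    have hb : ¬ G.IsBridge e := fun h => h.notMem_edges_of_isCycle hw he
    clear he heG
    induction e with
    | h x y => exact hconn.connected_delete_edge_of_not_isBridge hb
  -- A surviving cycle would be the unique cycle of `G`, hence would contain the deleted edge.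
  have hacyc : (G.deleteEdges {e}).IsAcyclic := by
    intro v p hp
    have h1 := huniq _ ⟨v, p.mapLe (SimpleGraph.deleteEdges_le _), hp.mapLe _, rfl⟩
    rw [← SimpleGraph.Walk.mem_edges_toSubgraph, ← h1, SimpleGraph.Walk.mem_edges_toSubgraph,
      SimpleGraph.Walk.edges_mapLe_eq_edges] at he
    have h2 := p.edges_subset_edgeSet he
    simp at h2
  have htree : (G.deleteEdges {e}).IsTree := ⟨hH, hacyc⟩
  have h1 := htree.card_edgeFinset
  have h2 : (G.deleteEdges {e}).edgeFinset = G.edgeFinset.erase e := by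
    ext e'
    simp only [SimpleGraph.mem_edgeFinset, SimpleGraph.edgeSet_deleteEdges, Set.mem_sdiff,
      Set.mem_singleton_iff, Finset.mem_erase]
    tauto
  rw [← h1, h2, Finset.card_erase_add_one (by simpa using heG)]

theorem exists_adj_dist_lt {G : SimpleGraph V} (hG : G.Connected) {x c : V} (h : x ≠ c) :
    ∃ y, G.Adj x y ∧ G.dist y c < G.dist x c := by
  obtain ⟨p, hp⟩ := hG.exists_walk_length_eq_dist x c
  cases p with
  | nil => exact absurd rfl h
  | cons hadj q =>
    refine ⟨_, hadj, ?_⟩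
    have := SimpleGraph.dist_le q
    rw [SimpleGraph.Walk.length_cons] at hp
    omega

/-- The vertices outside a nonempty set have neighbours closer to that set. -/
theorem exists_parent {G : SimpleGraph V} (hG : G.Connected) {C : Set V} (hC : C.Nonempty) :
    ∃ (f : V → V) (d : V → ℕ), ∀ x ∉ C, G.Adj x (f x) ∧ d (f x) < d x := by
  let d : V → ℕ := fun x => sInf {n | ∃ c ∈ C, G.dist x c = n}
  have hd : ∀ x, ∃ c ∈ C, G.dist x c = d x := fun x =>
    Nat.sInf_mem (s := {n | ∃ c ∈ C, G.dist x c = n}) (hC.elim fun c hc => ⟨_, c, hc, rfl⟩)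
  have key : ∀ x, ∃ y, x ∉ C → G.Adj x y ∧ d y < d x := by
    intro x
    by_cases hx : x ∈ C
    · exact ⟨x, fun h => absurd hx h⟩
    · obtain ⟨c, hc, hcd⟩ := hd x
      obtain ⟨y, hxy, hy⟩ := exists_adj_dist_lt hG (x := x) (c := c) (by rintro rfl; exact hx hc)
      refine ⟨y, fun _ => ⟨hxy, ?_⟩⟩
      rw [← hcd]
      exact lt_of_le_of_lt (Nat.sInf_le ⟨c, hc, rfl⟩) hy
  choose f hf using key
  exact ⟨f, d, hf⟩

/-- Let `next` follow the cycle, and off it move to a neighbour closer to the cycle. Since `next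
(next x) ≠ x`, the map from `x` to the edge `s(x, next x)` is injective; there are as many edges as
vertices, so every edge has this form. -/
theorem IsUnicyclic.exists_rooting [Fintype V] {G : SimpleGraph V} (hG : IsUnicyclic G) :
    ∃ R : Rooting G, cycleVerts G = R.core ∧
      ∀ e, e ∈ cycleEdges G ↔ ∃ x ∈ R.core, e = s(x, R.next x) := by
  classical
  have hcard := hG.card_edgeFinset
  obtain ⟨hconn, C, ⟨u, w, hw, rfl⟩, huniq⟩ := hG
  have h3 := hw.three_le_length
  have hinj : ∀ i < w.length, ∀ j < w.length, w.getVert i = w.getVert j → i = j :=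
    fun i hi j hj h => hw.getVert_injOn' (show i ≤ _ by omega) (show j ≤ _ by omega) h
  have hsupp : ∀ x, x ∈ w.support → ∃ i < w.length, w.getVert i = x := by
    intro x hx
    obtain ⟨i, hi, hil⟩ := SimpleGraph.Walk.mem_support_iff_exists_getVert.1 hx
    rcases hil.lt_or_eq with h | rfl
    · exact ⟨i, h, hi⟩
    · exact ⟨0, by omega, by rw [← hi]; simp⟩
  choose! idx hidx1 hidx2 using hsupp
  obtain ⟨f, d, hfd⟩ := exists_parent hconn (C := {x | x ∈ w.support}) ⟨u, w.start_mem_support⟩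
  let next : V → V := fun x => if x ∈ w.support then w.getVert (idx x + 1) else f x
  have hsup : ∀ i, w.getVert i ∈ w.support := fun i => w.getVert_mem_support i
  have hnext : ∀ i < w.length, next (w.getVert i) = w.getVert (i + 1) := by
    intro i hi
    have : idx (w.getVert i) = i := hinj _ (hidx1 _ (hsup i)) _ hi (hidx2 _ (hsup i))
    simp only [next, if_pos (hsup i), this]
  have hwrap : ∀ i ≤ w.length, w.getVert i = w.getVert (i % w.length) := by
    intro i hi
    rcases hi.lt_or_eq with h | rfl
    · rw [Nat.mod_eq_of_lt h]
    · simp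
  have hiter : ∀ i < w.length, ∀ j, next^[j] (w.getVert i) = w.getVert ((i + j) % w.length) := by
    intro i hi j
    induction j with
    | zero => rw [add_zero, Nat.mod_eq_of_lt hi]; rfl
    | succ j ih =>
      have hm := Nat.mod_lt (i + j) (show 0 < w.length by omega)
      rw [Function.iterate_succ_apply', ih, hnext _ hm, hwrap _ (by omega), Nat.mod_add_mod,
        add_assoc]
  have hoff : ∀ x, x ∉ w.support → next x = f x := fun x hx => if_neg hx
  have hmem : ∀ x ∈ w.support, next x ∈ w.support := by
    intro x hx
    rw [← hidx2 x hx, hnext _ (hidx1 x hx)]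
    exact hsup _
  have hadj : ∀ x, G.Adj x (next x) := by
    intro x
    by_cases hx : x ∈ w.support
    · rw [← hidx2 x hx, hnext _ (hidx1 x hx)]
      exact w.adj_getVert_succ (hidx1 x hx)
    · rw [hoff x hx]
      exact (hfd x hx).1
  have hlt : ∀ x, x ∉ w.support → d (next x) < d x := fun x hx => by
    rw [hoff x hx]; exact (hfd x hx).2
  have hne : ∀ i < w.length, ∀ j < w.length, 0 < j → next^[j] (w.getVert i) ≠ w.getVert i := by
    intro i hi j hj hj0 h
    rw [hiter i hi] at h
    have h1 := hinj _ (Nat.mod_lt _ (by omega)) _ hi h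
    rcases Nat.lt_or_ge (i + j) w.length with h2 | h2
    · rw [Nat.mod_eq_of_lt h2] at h1; omega
    · rw [Nat.mod_eq_sub_mod h2, Nat.mod_eq_of_lt (by omega)] at h1; omega
  have hnn : ∀ x, next (next x) ≠ x := by
    intro x h
    by_cases hx : x ∈ w.support
    · refine hne _ (hidx1 x hx) 2 (by omega) (by omega) ?_
      rw [hidx2 x hx]
      exact h
    · have h1 := hlt x hx
      by_cases hy : next x ∈ w.support
      · exact hx (h ▸ hmem _ hy)
      · have h2 := hlt _ hy
        rw [h] at h2
        omega
  let φ : V → G.edgeSet := fun x => ⟨s(x, next x), hadj x⟩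
  have hφ : Function.Injective φ := by
    intro x y hxy
    have h1 : s(x, next x) = s(y, next y) := congrArg Subtype.val hxy
    rw [Sym2.eq_iff] at h1
    rcases h1 with h1 | ⟨h1, h2⟩
    · exact h1.1
    · exact absurd (by rw [h2, ← h1]) (hnn x)
  have hφs : Function.Surjective φ := by
    refine ((Fintype.bijective_iff_injective_and_card φ).2 ⟨hφ, ?_⟩).2
    rw [← hcard, SimpleGraph.edgeFinset_card]
  have hreach : ∀ x, ∃ n, next^[n] x ∈ w.support := by
    intro x
    induction hn : d x using Nat.strong_induction_on generalizing x with
    | _ n ih =>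
      by_cases hx : x ∈ w.support
      · exact ⟨0, hx⟩
      · obtain ⟨m, hm⟩ := ih _ (hn ▸ hlt x hx) (next x) rfl
        exact ⟨m + 1, hm⟩
  let R : Rooting G :=
    { next := next
      core := {x | x ∈ w.support}
      len := w.length
      three_le_len := h3
      connected := hconn
      adj_iff := by
        intro x y
        constructor
        · intro hxy
          obtain ⟨z, hz⟩ := hφs ⟨s(x, y), hxy⟩
          have h1 : s(z, next z) = s(x, y) := congrArg Subtype.val hz
          rw [Sym2.eq_iff] at h1
          rcases h1 with ⟨rfl, h⟩ | ⟨rfl, h⟩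
          · exact Or.inl h
          · exact Or.inr h
        · rintro (rfl | rfl)
          · exact hadj x
          · exact (hadj y).symm
      next_mem := hmem
      exists_iterate_mem := hreach
      iterate_len := by
        intro a ha
        have h1 := hiter _ (hidx1 a ha) w.length
        rwa [hidx2 a ha, Nat.add_mod_right, Nat.mod_eq_of_lt (hidx1 a ha), hidx2 a ha] at h1
      iterate_ne := by
        intro a ha i hi hi0
        have h1 := hne _ (hidx1 a ha) i hi hi0
        rwa [hidx2 a ha] at h1
      exists_iterate_eq := by
        intro a ha b hb
        have hia := hidx1 a ha
        have hib := hidx1 b hb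
        refine ⟨(idx b + (w.length - idx a)) % w.length, Nat.mod_lt _ (by omega), ?_⟩
        have h1 := hiter _ hia ((idx b + (w.length - idx a)) % w.length)
        rw [hidx2 a ha, Nat.add_mod_mod,
          show idx a + (idx b + (w.length - idx a)) = idx b + w.length by omega,
          Nat.add_mod_right, Nat.mod_eq_of_lt hib, hidx2 b hb] at h1
        exact h1 }
  refine ⟨R, Set.ext fun x => mem_cycleVerts_iff hw huniq, fun e => ?_⟩
  rw [mem_cycleEdges_iff hw huniq]
  constructor
  · intro he
    induction e with
    | h x y =>
      rw [← SimpleGraph.Walk.adj_toSubgraph_iff_mem_edges,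
        SimpleGraph.Walk.toSubgraph_adj_iff] at he
      obtain ⟨i, hi, hil⟩ := he
      exact ⟨w.getVert i, hsup i, by rw [← hi]; exact congrArg _ (hnext i hil).symm⟩
  · rintro ⟨x, hx, rfl⟩
    rw [← SimpleGraph.Walk.adj_toSubgraph_iff_mem_edges]
    have h1 := w.toSubgraph_adj_getVert (hidx1 x hx)
    rwa [← hnext _ (hidx1 x hx), hidx2 x hx] at h1

/-! ### Hanging trees as fibres of the projection. -/

namespace Rooting

variable {G : SimpleGraph V} (R : Rooting G)

/-- Edges off the cycle preserve the projection, and the orbit from `u` to its projection uses only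
such edges. -/
theorem mem_hangingTree_iff
    (hedges : ∀ e, e ∈ cycleEdges G ↔ ∃ x ∈ R.core, e = s(x, R.next x)) {v u : V}
    (hv : v ∈ R.core) : u ∈ hangingTree G v ↔ R.proj u = v := by
  have hedge : ∀ x, s(x, R.next x) ∈ cycleEdges G ↔ x ∈ R.core := by
    intro x
    rw [hedges]
    constructor
    · rintro ⟨y, hy, h⟩
      rcases Sym2.eq_iff.1 h with ⟨rfl, -⟩ | ⟨rfl, -⟩
      · exact hy
      · exact R.next_mem y hy
    · exact fun hx => ⟨x, hx, rfl⟩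
  constructor
  · rintro ⟨p⟩
    rw [← R.proj_of_mem hv]
    clear hv
    induction p with
    | nil => rfl
    | @cons x y z hadj p ih =>
      rw [ih]
      rw [SimpleGraph.deleteEdges_adj] at hadj
      rcases (R.adj_iff x y).1 hadj.1 with rfl | rfl
      · exact R.proj_next (fun h => hadj.2 ((hedge x).2 h))
      · refine (R.proj_next (fun h => hadj.2 ?_)).symm
        rw [Sym2.eq_swap]
        exact (hedge y).2 h
  · rintro rfl
    have key : ∀ i ≤ R.depth u,
        (G.deleteEdges (cycleEdges G)).Reachable u (R.next^[i] u) := by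
      intro i
      induction i with
      | zero => exact fun _ => .refl u
      | succ i ih =>
        intro hi
        refine (ih (by omega)).trans (SimpleGraph.Adj.reachable ?_)
        rw [SimpleGraph.deleteEdges_adj, Function.iterate_succ_apply', hedge]
        exact ⟨R.adj_next _, R.iterate_notMem (by omega)⟩
    exact (key _ le_rfl).symm

end Rooting
-- The lower bound, and resolving sets avoiding a given vertex.
namespace Rooting

variable {G : SimpleGraph V} (R : Rooting G)

theorem exists_core_ne_ne (a v : V) : ∃ b ∈ R.core, b ≠ a ∧ b ≠ v := by
  obtain ⟨n, hn⟩ := R.exists_iterate_mem a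
  generalize R.next^[n] a = c at hn
  have h1 := R.next_ne c
  have h2 := R.next_ne (R.next c)
  have h3 := R.next_next_ne c
  have m1 := R.next_mem c hn
  have m2 := R.next_mem _ m1
  have key : ∀ x y z : V, x ≠ y → y ≠ z → x ≠ z →
      x ≠ a ∧ x ≠ v ∨ y ≠ a ∧ y ≠ v ∨ z ≠ a ∧ z ≠ v := by
    grind
  rcases key _ _ _ h1.symm h2.symm h3.symm with h | h | h
  · exact ⟨_, hn, h⟩
  · exact ⟨_, m1, h⟩
  · exact ⟨_, m2, h⟩

/-- A resolving set has vertices in the hanging trees of two vertices of the cycle. -/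
theorem exists_proj_ne_proj {S : Finset V} (hS : IsResolving G S) :
    ∃ s ∈ S, ∃ t ∈ S, R.proj s ≠ R.proj t := by
  by_contra! h
  obtain ⟨c, hc, hcS⟩ : ∃ c ∈ R.core, ∀ s ∈ S, R.proj s = c := by
    rcases S.eq_empty_or_nonempty with rfl | ⟨s, hs⟩
    · obtain ⟨x⟩ := R.connected.nonempty
      exact ⟨R.proj x, R.proj_mem x, by simp⟩
    · exact ⟨R.proj s, R.proj_mem s, fun t ht => h t ht s hs⟩
  obtain ⟨e, he, hec⟩ := R.exists_core_child hc
  have key : ∀ x ∈ R.core, G.Adj x c → ∀ s ∈ S, G.dist x s = 1 + R.depth s := by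
    intro x hx hxc s hs
    rw [R.dist_eq_depth_add_add, R.proj_of_mem hx, R.depth_of_mem hx, hcS s hs,
      SimpleGraph.dist_eq_one_iff_adj.2 hxc, zero_add]
    rw [R.proj_of_mem hx, hcS s hs]
    exact hxc.ne
  -- If all landmarks hang at `c`, the two neighbours of `c` on the cycle are not resolved.
  have hne : R.next c ≠ e := by
    rw [← hec]
    exact R.next_next_ne e
  obtain ⟨s, hs, hsne⟩ := hS _ _ hne
  rw [key _ (R.next_mem c hc) (R.adj_next c).symm s hs,
    key e he (hec ▸ R.adj_next e) s hs] at hsne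
  exact hsne rfl

variable [Fintype V] [DecidableRel G.Adj]

open Classical in
/-- The leaves in which the threads attached to `v` end. -/
noncomputable def threadEnds (v : V) : Finset V := {u | G.degree u = 1 ∧ R.head u = v}

theorem mem_threadEnds {u v : V} : u ∈ R.threadEnds v ↔ G.degree u = 1 ∧ R.head u = v := by
  simp [threadEnds]

theorem numThreads_eq (v : V) : numThreads G v = (R.threadEnds v).card := by
  rw [numThreads, ← Set.ncard_coe_finset]
  congr 1
  ext u
  rw [Finset.mem_coe, R.mem_threadEnds]
  exact R.exists_isThread_iff

theorem branchSum_eq : branchSum G = ∑ v, ((R.threadEnds v).card - 1) := by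
  rw [branchSum, Finset.sum_filter]
  refine Finset.sum_congr rfl fun v _ => ?_
  rw [R.numThreads_eq]
  split_ifs <;> omega

/-- A landmark outside both threads is reached from either top through the common head, so it does
not resolve the two tops. -/
theorem exists_mem_below_top {S : Finset V} (hS : IsResolving G S) {u w : V}
    (hu : G.degree u = 1) (hw : G.degree w = 1) (huw : u ≠ w) (h : R.head u = R.head w) :
    ∃ s ∈ S, s ∈ R.below (R.top u) ∨ s ∈ R.below (R.top w) := by
  have hne : R.top u ≠ R.top w := fun h' =>
    huw (R.eq_of_mem_below_top hu hw (R.mem_below_top u) (h' ▸ R.mem_below_top u))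
  obtain ⟨s, hs, hd⟩ := hS _ _ hne
  refine ⟨s, hs, ?_⟩
  by_contra! hcon
  rw [R.dist_eq_of_notMem_below (R.top_notMem hu) hcon.1,
    R.dist_eq_of_notMem_below (R.top_notMem hw) hcon.2, R.next_top hu, R.next_top hw, h] at hd
  exact hd rfl

section

variable (hcore : cycleVerts G = R.core)
  (hedges : ∀ e, e ∈ cycleEdges G ↔ ∃ x ∈ R.core, e = s(x, R.next x))
include hcore hedges

theorem isBranchActive_iff {v : V} : IsBranchActive G v ↔ v ∈ R.core ∧
    ∃ y z, y ≠ z ∧ y ∉ R.core ∧ z ∉ R.core ∧ R.next y = R.next z ∧ R.proj y = v := by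
  rw [IsBranchActive, hcore]
  refine and_congr_right fun hv => ?_
  constructor
  · rintro ⟨q, hq, hb⟩
    obtain ⟨y, z, hyz, hy, hz, rfl, hzq⟩ := (R.isBranching_iff hcore).1 hb
    rw [R.mem_hangingTree_iff hedges hv, R.proj_next hy] at hq
    exact ⟨y, z, hyz, hy, hz, hzq.symm, hq⟩
  · rintro ⟨y, z, hyz, hy, hz, h, hyv⟩
    refine ⟨R.next y, ?_, (R.isBranching_iff hcore).2 ⟨y, z, hyz, hy, hz, rfl, h.symm⟩⟩
    rw [R.mem_hangingTree_iff hedges hv, R.proj_next hy, hyv]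

/-- Landmarks counted by `L(G)` hang at branch-active vertices; this keeps the two contributions to
the lower bound disjoint. -/
theorem isBranchActive_proj {u w s : V} (hu : G.degree u = 1) (hw : G.degree w = 1) (huw : u ≠ w)
    (h : R.head u = R.head w) (hs : s ∈ R.below (R.top u)) : IsBranchActive G (R.proj s) := by
  rw [R.isBranchActive_iff hcore hedges]
  refine ⟨R.proj_mem s, R.top u, R.top w, fun h' => ?_, R.top_notMem hu, R.top_notMem hw, ?_, ?_⟩
  · exact huw (R.eq_of_mem_below_top hu hw (R.mem_below_top u) (h' ▸ R.mem_below_top u))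
  · rw [R.next_top hu, R.next_top hw, h]
  · rw [R.proj_of_mem_below (R.top_notMem hu) hs]

/-- The lower bound on the size of resolving sets. -/
theorem branchSum_add_le_card {S : Finset V} (hS : IsResolving G S) :
    branchSum G + (2 - numBranchActive G) ≤ S.card := by
  classical
  have hsplit := Finset.card_filter_add_card_filter_not (s := S)
    (fun s => IsBranchActive G (R.proj s))
  have hactive : branchSum G ≤ (S.filter fun s => IsBranchActive G (R.proj s)).card := by
    -- The leaves whose thread contains a landmark, at heads with several threads. At most one leaf
    -- per head is missing, and disjointness of threads makes the choice of a landmark injective.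
    let W : Finset V := {u | G.degree u = 1 ∧ 1 < (R.threadEnds (R.head u)).card ∧
      ∃ s ∈ S, s ∈ R.below (R.top u)}
    have hW : branchSum G ≤ W.card := by
      rw [R.branchSum_eq,
        Finset.card_eq_sum_card_fiberwise (f := R.head) (t := Finset.univ) (by simp)]
      refine Finset.sum_le_sum fun v _ => ?_
      by_cases hv : 1 < (R.threadEnds v).card
      · have h1 : (R.threadEnds v \ W).card ≤ 1 := by
          rw [Finset.card_le_one]
          intro u hu w hw
          by_contra huw
          rw [Finset.mem_sdiff, R.mem_threadEnds] at hu hw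
          obtain ⟨⟨hu1, hu2⟩, huW⟩ := hu
          obtain ⟨⟨hw1, hw2⟩, hwW⟩ := hw
          simp only [W, Finset.mem_filter, Finset.mem_univ, true_and, not_and] at huW hwW
          obtain ⟨s, hs, h | h⟩ := R.exists_mem_below_top hS hu1 hw1 huw (hu2.trans hw2.symm)
          · exact huW hu1 (by rwa [hu2]) ⟨s, hs, h⟩
          · exact hwW hw1 (by rwa [hw2]) ⟨s, hs, h⟩
        have h2 : R.threadEnds v ⊆ (R.threadEnds v \ W) ∪ W.filter fun u => R.head u = v := by
          intro u hu
          by_cases huW : u ∈ W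
          · exact Finset.mem_union_right _ (Finset.mem_filter.2 ⟨huW, (R.mem_threadEnds.1 hu).2⟩)
          · exact Finset.mem_union_left _ (Finset.mem_sdiff.2 ⟨hu, huW⟩)
        have h3 := (Finset.card_le_card h2).trans (Finset.card_union_le _ _)
        omega
      · omega
    refine hW.trans ?_
    have hσ : ∀ u, ∃ s, u ∈ W → s ∈ S ∧ s ∈ R.below (R.top u) := by
      intro u
      by_cases hu : u ∈ W
      · obtain ⟨s, hs⟩ := (Finset.mem_filter.1 hu).2.2.2
        exact ⟨s, fun _ => hs⟩
      · exact ⟨u, fun h => absurd h hu⟩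
    choose σ hσ using hσ
    refine Finset.card_le_card_of_injOn σ ?_ ?_
    · intro u hu
      have hu' := (Finset.mem_filter.1 hu).2
      obtain ⟨w, hw, hwu⟩ := Finset.exists_mem_ne hu'.2.1 u
      rw [R.mem_threadEnds] at hw
      rw [Finset.mem_coe, Finset.mem_filter]
      exact ⟨(hσ u hu).1, R.isBranchActive_proj hcore hedges hu'.1 hw.1 hwu.symm hw.2.symm
        (hσ u hu).2⟩
    · intro u hu w hw h
      exact R.eq_of_mem_below_top (Finset.mem_filter.1 hu).2.1 (Finset.mem_filter.1 hw).2.1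
        (hσ u hu).2 (h ▸ (hσ w hw).2)
  have hrest : 2 - numBranchActive G ≤
      (S.filter fun s => ¬ IsBranchActive G (R.proj s)).card := by
    let B : Finset V := {v | IsBranchActive G v}
    have hB : numBranchActive G = B.card := by
      rw [numBranchActive, ← Set.ncard_coe_finset]
      congr 1
      ext v
      simp [B]
    -- The projections of `S` form at least two cycle vertices, of which at most `b(G)` are active;
    -- each remaining one needs a landmark of its own.
    have h1 : S.image R.proj ⊆
        B ∪ (S.filter fun s => ¬ IsBranchActive G (R.proj s)).image R.proj := by
      intro v hv
      obtain ⟨s, hs, rfl⟩ := Finset.mem_image.1 hv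
      by_cases hsB : IsBranchActive G (R.proj s)
      · exact Finset.mem_union_left _ (by simpa [B] using hsB)
      · exact Finset.mem_union_right _
          (Finset.mem_image_of_mem _ (Finset.mem_filter.2 ⟨hs, hsB⟩))
    have h2 : 1 < (S.image R.proj).card := by
      obtain ⟨s, hs, t, ht, hst⟩ := R.exists_proj_ne_proj hS
      exact Finset.one_lt_card.2 ⟨_, Finset.mem_image_of_mem _ hs, _,
        Finset.mem_image_of_mem _ ht, hst⟩
    have h3 := (Finset.card_le_card h1).trans (Finset.card_union_le _ _)
    have h4 := Finset.card_image_le (f := R.proj)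
      (s := S.filter fun s => ¬ IsBranchActive G (R.proj s))
    omega
  omega

/-- Two vertices of the cycle such that at most `2 - b(G)` of them are not branch-active, and
these are different from a given vertex. -/
theorem exists_active_pair (v : V) : ∃ a ∈ R.core, ∃ b ∈ R.core, a ≠ b ∧ ∃ E : Finset V,
    E.card ≤ 2 - numBranchActive G ∧ v ∉ E ∧ (∀ x ∈ E, x ∈ R.core) ∧
      (IsBranchActive G a ∨ a ∈ E) ∧ (IsBranchActive G b ∨ b ∈ E) := by
  classical
  let B : Finset V := {v | IsBranchActive G v}
  have hmem : ∀ x, x ∈ B ↔ IsBranchActive G x := by simp [B]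
  have hBc : ∀ x ∈ B, x ∈ R.core := fun x hx =>
    ((R.isBranchActive_iff hcore hedges).1 ((hmem x).1 hx)).1
  have hB : numBranchActive G = B.card := by
    rw [numBranchActive, ← Set.ncard_coe_finset]
    congr 1
    ext x
    simp [B]
  rw [hB]
  by_cases h2 : 1 < B.card
  · obtain ⟨a, ha, b, hb, hab⟩ := Finset.one_lt_card.1 h2
    exact ⟨a, hBc a ha, b, hBc b hb, hab, ∅, by simp, by simp, by simp,
      Or.inl ((hmem a).1 ha), Or.inl ((hmem b).1 hb)⟩
  · rcases B.eq_empty_or_nonempty with h0 | ⟨a, ha⟩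
    · obtain ⟨a, ha, -, hav⟩ := R.exists_core_ne_ne v v
      obtain ⟨b, hb, hba, hbv⟩ := R.exists_core_ne_ne a v
      refine ⟨a, ha, b, hb, hba.symm, {a, b}, ?_, ?_, ?_, Or.inr (by simp), Or.inr (by simp)⟩
      · rw [h0, Finset.card_empty]
        exact Finset.card_le_two
      · simp [hav.symm, hbv.symm]
      · simp [ha, hb]
    · obtain ⟨b, hb, hba, hbv⟩ := R.exists_core_ne_ne a v
      refine ⟨a, hBc a ha, b, hb, hba.symm, {b}, ?_, ?_, ?_, Or.inl ((hmem a).1 ha),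
        Or.inr (by simp)⟩
      · rw [Finset.card_singleton]
        omega
      · simp [hbv.symm]
      · simp [hb]

/-- Any vertex is avoided by a resolving set with at most one vertex more than the lower bound. -/
theorem exists_isResolving_notMem (v : V) : ∃ S : Finset V, IsResolving G S ∧ v ∉ S ∧
    S.card ≤ branchSum G + (2 - numBranchActive G) + 1 := by
  classical
  -- Drop one thread end per head, namely `v` itself if it is among them.
  have hT : ∀ x, ∃ T ⊆ R.threadEnds x, v ∉ T ∧ T.card ≤ (R.threadEnds x).card - 1 ∧
      ∀ u ∈ R.threadEnds x, ∀ w ∈ R.threadEnds x, u ≠ w → u ∈ T ∨ w ∈ T := by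
    intro x
    rcases (R.threadEnds x).eq_empty_or_nonempty with h0 | ⟨r, hr⟩
    · exact ⟨∅, by simp, by simp, by simp, by simp [h0]⟩
    · obtain ⟨o, ho, hov⟩ : ∃ o ∈ R.threadEnds x, v ∉ (R.threadEnds x).erase o := by
        by_cases hv : v ∈ R.threadEnds x
        · exact ⟨v, hv, by simp⟩
        · exact ⟨r, hr, fun h => hv (Finset.mem_of_mem_erase h)⟩
      refine ⟨(R.threadEnds x).erase o, Finset.erase_subset _ _, hov,
        (Finset.card_erase_of_mem ho).le, fun u hu w hw huw => ?_⟩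
      by_cases huo : u = o
      · exact Or.inr (Finset.mem_erase.2 ⟨by rintro rfl; exact huw huo, hw⟩)
      · exact Or.inl (Finset.mem_erase.2 ⟨huo, hu⟩)
  choose T _ hTv hTcard hTS using hT
  obtain ⟨a, ha, b, hb, hab, E, hEcard, hvE, hEc, haE, hbE⟩ :=
    R.exists_active_pair hcore hedges v
  -- The vertex `c` is the one vertex in excess of the lower bound.
  obtain ⟨c, hc, hcv, hdr⟩ := R.exists_isDoublyResolving ha hb hab v
  have hleaf : ∀ u w, G.degree u = 1 → G.degree w = 1 → u ≠ w → R.head u = R.head w →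
      u ∈ Finset.univ.biUnion T ∨ w ∈ Finset.univ.biUnion T := by
    intro u w hu hw huw h
    have := hTS (R.head w) u (R.mem_threadEnds.2 ⟨hu, h⟩) w (R.mem_threadEnds.2 ⟨hw, rfl⟩) huw
    simp only [Finset.mem_biUnion, Finset.mem_univ, true_and]
    exact this.imp (fun h => ⟨_, h⟩) (fun h => ⟨_, h⟩)
  have hbelow := fun x y hx hy hxy h =>
    R.exists_mem_below_of_sibling hleaf (x := x) (y := y) hx hy hxy h
  -- The tree of an active vertex contains two siblings, so it already holds a thread end from `T`.
  have hact : ∀ x, IsBranchActive G x ∨ x ∈ E →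
      ∃ s ∈ insert c (E ∪ Finset.univ.biUnion T), R.proj s = x := by
    rintro x (hx | hx)
    · obtain ⟨-, y, z, hyz, hy, hz, h, rfl⟩ := (R.isBranchActive_iff hcore hedges).1 hx
      obtain ⟨s, hs, hsb⟩ := hbelow y z hy hz hyz h
      refine ⟨s, by simp only [Finset.mem_insert, Finset.mem_union, hs, or_true], ?_⟩
      rcases hsb with hsb | hsb
      · exact R.proj_of_mem_below hy hsb
      · rw [R.proj_of_mem_below hz hsb, ← R.proj_next hz, ← h, R.proj_next hy]
    · exact ⟨x, by simp [hx], R.proj_of_mem (hEc x hx)⟩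
  refine ⟨insert c (E ∪ Finset.univ.biUnion T), ?_, ?_, ?_⟩
  · refine R.isResolving_of_isDoublyResolving hdr ?_ ?_
    · rintro x (rfl | rfl | rfl)
      · exact hact _ haE
      · exact hact _ hbE
      · exact ⟨x, by simp, R.proj_of_mem hc⟩
    · intro x y hx hy hxy h
      obtain ⟨s, hs, hsb⟩ := hbelow x y hx hy hxy h
      exact ⟨s, by simp only [Finset.mem_insert, Finset.mem_union, hs, or_true], hsb⟩
  · simp only [Finset.mem_insert, Finset.mem_union, Finset.mem_biUnion, Finset.mem_univ, true_and,
      not_or, not_exists]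
    exact ⟨hcv.symm, hvE, hTv⟩
  · have h1 := Finset.card_insert_le c (E ∪ Finset.univ.biUnion T)
    have h2 := Finset.card_union_le E (Finset.univ.biUnion T)
    have h3 : (Finset.univ.biUnion T).card ≤ branchSum G := by
      rw [R.branchSum_eq]
      exact Finset.card_biUnion_le.trans (Finset.sum_le_sum fun x _ => hTcard x)
    omega

end

end Rooting

/-! ### The metric dimension as an attained minimum, and the conclusion. -/

theorem isResolving_univ [Fintype V] {G : SimpleGraph V} (hG : G.Connected) :
    IsResolving G Finset.univ := fun x y hxy =>
  ⟨x, Finset.mem_univ x, by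
    rw [SimpleGraph.dist_self]
    exact fun h => hxy (hG.dist_eq_zero_iff.1 h.symm).symm⟩

theorem exists_isResolving_card_eq [Fintype V] {G : SimpleGraph V} (hG : G.Connected) :
    ∃ S : Finset V, IsResolving G S ∧ S.card = metricDim G :=
  Nat.sInf_mem (s := {n | ∃ S : Finset V, IsResolving G S ∧ S.card = n})
    ⟨_, Finset.univ, isResolving_univ hG, rfl⟩

theorem metricDim_le_card {G : SimpleGraph V} {S : Finset V} (hS : IsResolving G S) :
    metricDim G ≤ S.card := Nat.sInf_le ⟨S, hS, rfl⟩

end UnicyclicMetric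

theorem mainTheorem4 {V : Type*} [Fintype V] (G : SimpleGraph V) [DecidableRel G.Adj]
    (hG : UnicyclicMetric.IsUnicyclic G) (hg : 4 ≤ G.girth)
    (hforced : ∃ v : V, UnicyclicMetric.IsBasisForced G v) :
    (UnicyclicMetric.metricDim G : ℤ) =
      (UnicyclicMetric.branchSum G : ℤ) +
        max (2 - (UnicyclicMetric.numBranchActive G : ℤ)) 0 := by
  obtain ⟨v, hv⟩ := hforced
  obtain ⟨R, hcore, hedges⟩ := hG.exists_rooting
  obtain ⟨S, hS, hSdim⟩ := UnicyclicMetric.exists_isResolving_card_eq hG.1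
  have hlow := R.branchSum_add_le_card hcore hedges hS
  obtain ⟨T, hT, hvT, hTcard⟩ := R.exists_isResolving_notMem hcore hedges v
  -- Equality would make `T` a metric basis missing the forced vertex `v`.
  have hTne : UnicyclicMetric.metricDim G < T.card := by
    by_contra! hle
    exact hvT (hv T ⟨hT, fun U hU => hle.trans (UnicyclicMetric.metricDim_le_card hU)⟩)
  omega
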